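/- **Theorem (Graham–Rothschild).** Let $\Sigma$ be a finite alphabet and fix pairwise distinct symbols $\lambda_0,\lambda_1,\dots$ (the parameters) that do not belong to $\Sigma$. For natural numbers $k,n$ and $\Pi\subseteq\Sigma$, a *$k$-parameter word of length $n$ in the alphabet $\Pi$* is a word $W=W_0W_1\cdots W_{n-1}$ over $\Pi\cup\{\lambda_0,\dots,\lambda_{k-1}\}$ in which every $\lambda_i$ with $0\le i<k$ occurs and, for every $0<i<k$, the first occurrence of $\lambda_i$ comes after the first occurrence of $\lambda_{i-1}$. If $W$ is an $m$-parameter word of length $N$ in the alphabet $\Sigma$ and $U=U_0\cdots U_{m-1}$ is a $k$-parameter word of length $m$ in the alphabet $\Sigma$, then $W(U)$ denotes the $k$-parameter word of length $N$ in the alphabet $\Sigma$ obtained from $W$ by replacing every occurrence of $\lambda_i$ by $U_i$, for each $0\le i<m$. For every pair of finite alphabets $\Pi\subseteq\Sigma$ (either may be empty) and all natural numbers $k,m,r$ with $0<k<m$ and $r>0$, there is a positive integer $N$ such that for every $r$-colouring of the $k$-parameter words of length $N$ in the alphabet $\Sigma$ there exists an $m$-parameter word $W$ of length $N$ in the alphabet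 $\Pi$ such that the set $$\{W(U) : U \text{ is a } k\text{-parameter word of length } m \text{ in the alphabet } \Pi\}$$ is monochromatic. (For $\Pi=\Sigma$ this is the usual Graham–Rothschild theorem over one alphabet.) -/

import Mathlib

/-- A `k`-parameter word of length `n` in the alphabet `A` (with `k` and `n` finite): a word over
`A ∪ {λ_0, …, λ_{k-1}}`, where `Sum.inl a` is the letter `a` and `Sum.inr i` is the parameter
`λ_i`.  Every parameter occurs, and the first occurrence of `λ_{i+1}` comes after the first
occurrence of `λ_i` (that is, every occurrence of `λ_{i+1}` is preceded by one of `λ_i`). -/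
structure ParamWord (A : Type*) (k n : ℕ) where
  letter : Fin n → A ⊕ Fin k
  occurs : ∀ i : Fin k, ∃ p : Fin n, letter p = Sum.inr i
  ordered : ∀ i j : Fin k, (i : ℕ) + 1 = (j : ℕ) →
    ∀ q : Fin n, letter q = Sum.inr j → ∃ p : Fin n, p < q ∧ letter p = Sum.inr i

namespace ParamWord

variable {A : Type*} {k m n : ℕ}

/-- All letters of the word that are not parameters belong to the alphabet `P`. -/
def InAlphabet (W : ParamWord A k n) (P : Set A) : Prop :=
  ∀ (p : Fin n) (a : A), W.letter p = Sum.inl a → a ∈ P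

theorem exists_before (W : ParamWord A k n) (d : ℕ) :
    ∀ (i j : Fin k), (i : ℕ) + (d + 1) = (j : ℕ) →
      ∀ q : Fin n, W.letter q = Sum.inr j → ∃ p : Fin n, p < q ∧ W.letter p = Sum.inr i := by
  induction d with
  | zero => exact fun i j h => W.ordered i j h
  | succ d ih =>
    intro i j h q hq
    have hj := j.isLt
    obtain ⟨p, hp, hpl⟩ := W.ordered ⟨i + (d + 1), by omega⟩ j (by simp; omega) q hq
    obtain ⟨p', hp', hpl'⟩ := ih i ⟨i + (d + 1), by omega⟩ rfl p hpl
    exact ⟨p', hp'.trans hp, hpl'⟩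

/-- The substitution `W(U)`: every occurrence of `λ_i` in the `m`-parameter word `W` is replaced
by the `i`-th symbol of `U`.  As `U` has length `m`, no truncation takes place. -/
def subst (W : ParamWord A m n) (U : ParamWord A k m) : ParamWord A k n where
  letter p := Sum.elim Sum.inl U.letter (W.letter p)
  occurs i := by
    obtain ⟨s, hs⟩ := U.occurs i
    obtain ⟨p, hp⟩ := W.occurs s
    exact ⟨p, by simp [hp, hs]⟩
  ordered i j hij q hq := by
    cases hW : W.letter q with
    | inl a => simp [hW] at hq
    | inr s =>
      simp only [hW, Sum.elim_inr] at hq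
      obtain ⟨t, hts, ht⟩ := U.ordered i j hij s hq
      have hts' : (t : ℕ) < (s : ℕ) := hts
      obtain ⟨p, hp, hpl⟩ := W.exists_before ((s : ℕ) - t - 1) t s (by omega) q hW
      exact ⟨p, hp, by simp [hpl, ht]⟩

end ParamWord

/-! Only words over `Π` matter, since `W(U)` is over `Π`. They are coded as lists of naturals:
letters are `0, …, a - 1`, parameters are `a, a + 1, …`.

The induction is on the number of parameters, for all alphabet sizes at once. A word with `d + 1`
parameters is `u ++ a :: v` with `u` over the letters. After its first occurrence the parameter `a`
behaves like a letter, so `v` is a `d`-parameter word over `a + 1` letters.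

The induction hypothesis, applied once for each length of `u`, makes the colour depend on `u` only
(`exists_color_eq_of_initial_eq`). What remains is a colouring of words over the letters. Iterated
Hales–Jewett makes it depend on the length of the substituted word only, and the pigeonhole
principle removes that dependence (`exists_initial_color_eq`). The case of no parameters is
multidimensional Hales–Jewett. -/

/-! ### Restricted growth words and substitution -/

/-- `Growth a k w`: reading `w` after the symbols `0, …, a - 1` have been seen, every symbol is
either already seen or the least unseen one, and at the end exactly `0, …, k - 1` have been seen. -/
inductive Growth : ℕ → ℕ → List ℕ → Prop
  | nil (k : ℕ) : Growth k k []
  | old {a k i : ℕ} {w : List ℕ} : i < a → Growth a k w → Growth a k (i :: w)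
  | new {a k : ℕ} {w : List ℕ} : Growth (a + 1) k w → Growth a k (a :: w)

/-- The symbol replacing `i` when the parameters `a, a + 1, …` are replaced by the entries
of `U` and the letters `0, …, a - 1` are kept. -/
def fill (a : ℕ) (U : List ℕ) (i : ℕ) : ℕ := if i < a then i else U.getD (i - a) 0

theorem fill_of_lt {a i : ℕ} (U : List ℕ) (h : i < a) : fill a U i = i := if_pos h

theorem fill_add (a i : ℕ) (U : List ℕ) : fill a U (a + i) = U.getD i 0 := by simp [fill]

theorem fill_append_of_lt {a i : ℕ} (U V : List ℕ) (h : i < a + U.length) :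
    fill a (U ++ V) i = fill a U i := by
  unfold fill
  split_ifs with h'
  · rfl
  · exact List.getD_append _ _ _ _ (by omega)

theorem fill_length (a x : ℕ) (U V : List ℕ) : fill a (U ++ x :: V) (a + U.length) = x := by
  rw [fill_add, List.getD_append_right _ _ _ _ le_rfl]; simp

theorem map_fill_append {a : ℕ} {W : List ℕ} (U V : List ℕ) (h : ∀ i ∈ W, i < a + U.length) :
    W.map (fill a (U ++ V)) = W.map (fill a U) :=
  List.map_congr_left fun i hi => fill_append_of_lt _ _ (h i hi)

theorem fill_fill {a i : ℕ} (U V : List ℕ) (h : i < a + U.length) :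
    fill a V (fill a U i) = fill a (U.map (fill a V)) i := by
  by_cases h' : i < a
  · simp [fill_of_lt, h']
  · obtain ⟨j, rfl⟩ := Nat.exists_eq_add_of_le (not_lt.1 h')
    have hj : j < U.length := by omega
    simp only [fill_add]
    rw [List.getD_eq_getElem _ _ hj, List.getD_eq_getElem _ _ (by simpa using hj)]
    simp

theorem map_fill_map_fill {a : ℕ} {W : List ℕ} (U V : List ℕ) (h : ∀ i ∈ W, i < a + U.length) :
    (W.map (fill a U)).map (fill a V) = W.map (fill a (U.map (fill a V))) := by
  rw [List.map_map]
  exact List.map_congr_left fun i hi => fill_fill _ _ (h i hi)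

theorem map_fill_range' (a : ℕ) (U : List ℕ) {n : ℕ} (h : n ≤ U.length) :
    (List.range' a n).map (fill a U) = U.take n := by
  apply List.ext_getElem
  · simp [h]
  · intro i h1 h2
    simp only [List.length_map, List.length_range'] at h1
    simp [fill_add, show i < U.length by omega]

theorem map_fill_lt {a : ℕ} {W U : List ℕ} {b : ℕ} (hab : a ≤ b) (hW : ∀ i ∈ W, i < a + U.length)
    (hU : ∀ i ∈ U, i < b) : ∀ i ∈ W.map (fill a U), i < b := by
  intro i hi
  obtain ⟨j, hj, rfl⟩ := List.mem_map.1 hi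
  by_cases h : j < a
  · rw [fill_of_lt _ h]; omega
  · obtain ⟨l, rfl⟩ := Nat.exists_eq_add_of_le (not_lt.1 h)
    have := hW _ hj
    rw [fill_add, List.getD_eq_getElem _ _ (by omega)]
    exact hU _ (List.getElem_mem _)

namespace Growth

variable {a b k m n : ℕ} {w u v U W : List ℕ}

theorem le (h : Growth a k w) : a ≤ k := by
  induction h with
  | nil => rfl
  | old _ _ ih => exact ih
  | new _ ih => omega

theorem lt (h : Growth a k w) : ∀ i ∈ w, i < k := by
  induction h with
  | nil => simp
  | old hi h ih => simpa using ⟨hi.trans_le h.le, by simpa using ih⟩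
  | new h ih => simpa using ⟨h.le, by simpa using ih⟩

theorem le_length (h : Growth a k w) : k ≤ a + w.length := by
  induction h with
  | nil => simp
  | old hi h ih => simp only [List.length_cons]; omega
  | new h ih => simp only [List.length_cons]; omega

theorem append (h : Growth a b u) (h' : Growth b k v) : Growth a k (u ++ v) := by
  induction h with
  | nil => exact h'
  | old hi _ ih => exact .old hi (ih h')
  | new _ ih => exact .new (ih h')

theorem of_lt (h : ∀ i ∈ w, i < a) : Growth a a w := by
  induction w with
  | nil => exact .nil a
  | cons x w ih => exact .old (h x (by simp)) (ih fun i hi => h i (by simp [hi]))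

theorem range' (a n : ℕ) : Growth a (a + n) (List.range' a n) := by
  induction n generalizing a with
  | zero => exact .nil a
  | succ n ih =>
    rw [List.range'_succ]
    have := ih (a + 1)
    rw [show a + 1 + n = a + (n + 1) by omega] at this
    exact .new this

theorem of_append_of_lt (h : Growth a k (u ++ v)) (hu : ∀ i ∈ u, i < a) : Growth a k v := by
  induction u with
  | nil => exact h
  | cons x u ih =>
    rcases h with _ | ⟨_, h⟩ | h
    · exact ih h fun i hi => hu i (by simp [hi])
    · exact absurd (hu a (by simp)) (lt_irrefl _)

theorem of_cons_self (h : Growth a k (a :: v)) : Growth (a + 1) k v := by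
  rcases h with _ | ⟨h', _⟩ | h
  · exact absurd h' (lt_irrefl _)
  · exact h

/-- Cut at the first occurrence of `b`. For `b = a` this separates a word over the letters from a
word in which `a` counts as a letter. -/
theorem exists_split (h : Growth a k w) (hab : a ≤ b) (hbk : b < k) :
    ∃ u v, w = u ++ b :: v ∧ Growth a b u ∧ Growth (b + 1) k v := by
  induction h with
  | nil => omega
  | old hi h ih =>
    obtain ⟨u, v, rfl, hu, hv⟩ := ih hab hbk
    exact ⟨_ :: u, v, rfl, .old hi hu, hv⟩
  | @new a k w h ih =>
    rcases hab.eq_or_lt with rfl | hab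
    · exact ⟨[], w, rfl, .nil a, h⟩
    · obtain ⟨u, v, rfl, hu, hv⟩ := ih hab hbk
      exact ⟨a :: u, v, rfl, .new hu, hv⟩

/-- The invariant behind substitution: the parameters already seen in the outer word account for the
part `u` of the inner word, and each new one uses up the next entry of `v`. -/
theorem map_fill_aux {j c : ℕ} (h : Growth j m W) (hU : Growth a c u) (hj : j = a + u.length)
    (hV : Growth c k v) (hm : m = j + v.length) :
    Growth c k (W.map (fill a (u ++ v))) := by
  induction h generalizing u v c with
  | nil =>
    obtain rfl : v = [] := List.length_eq_zero_iff.1 (by omega)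
    cases hV
    exact .nil _
  | @old j m i W hi h ih =>
    refine .old ?_ (ih hU hj hV hm)
    rw [fill_append_of_lt _ _ (by omega)]
    refine map_fill_lt (W := [i]) hU.le (by simpa using by omega) hU.lt _ (List.mem_map_of_mem ?_)
    exact List.mem_singleton_self _
  | @new j m W h ih =>
    have := h.le
    rcases v with _ | ⟨x, v⟩
    · simp at hm; omega
    · rw [List.map_cons, hj, fill_length]
      rw [List.length_cons] at hm
      have key : ∀ c', Growth c c' [x] → Growth c' k v →
          Growth c' k (W.map (fill a (u ++ x :: v))) := by
        intro c' h1 h2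
        have := ih (u := u ++ [x]) (v := v) (hU.append h1) (by simp; omega) h2 (by omega)
        simpa using this
      rcases hV with _ | ⟨hx, hV⟩ | hV
      · exact .old hx (key c (.old hx (.nil c)) hV)
      · exact .new (key _ (.new (.nil _)) hV)

/-- Substitution of growth words. -/
theorem map_fill (hW : Growth a (a + m) W) (hU : Growth a k U) (hm : U.length = m) :
    Growth a k (W.map (fill a U)) :=
  hW.map_fill_aux (u := []) (.nil a) rfl hU (by simp [hm])

/-- Renumbering that makes room for `p` extra parameters in front of the existing ones. -/
theorem map_shift {p : ℕ} (h : Growth b k w) (hab : a ≤ b) :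
    Growth (b + p) (k + p) (w.map fun i => if i < a then i else i + p) := by
  induction h with
  | nil => exact .nil _
  | old hi h ih =>
    refine .old ?_ (ih hab)
    dsimp only
    split_ifs <;> omega
  | new h ih =>
    rw [List.map_cons, if_neg (by omega)]
    refine .new ?_
    have := ih (by omega)
    rwa [show ∀ x, x + 1 + p = x + p + 1 by intros; omega] at this

end Growth

/-! ### Initial segments before a parameter -/

/-- The longest initial segment of a word all of whose entries are below `b`. -/
def initial (b : ℕ) (w : List ℕ) : List ℕ := w.takeWhile (· < b)

theorem initial_append_cons {b : ℕ} {u : List ℕ} (v : List ℕ) (h : ∀ i ∈ u, i < b) :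
    initial b (u ++ b :: v) = u := by
  rw [initial, List.takeWhile_append_of_pos (by simpa using h)]
  simp

theorem Growth.exists_initial {a b k : ℕ} {w : List ℕ} (h : Growth a k w) (hab : a ≤ b)
    (hbk : b < k) : ∃ v, w = initial b w ++ b :: v ∧ Growth a b (initial b w) ∧
      Growth (b + 1) k v := by
  obtain ⟨u, v, rfl, hu, hv⟩ := h.exists_split hab hbk
  rw [initial_append_cons v hu.lt]
  exact ⟨v, rfl, hu, hv⟩

/-- The initial segment of a substituted word. -/
theorem Growth.map_fill_eq {a b m : ℕ} {W u v : List ℕ} (hW : Growth a (a + m) W)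
    (hm : (u ++ b :: v).length = m) :
    ∃ z, W.map (fill a (u ++ b :: v)) =
      (initial (a + u.length) W).map (fill a u) ++ b :: z := by
  obtain ⟨y, hy, h1, -⟩ := hW.exists_initial (b := a + u.length) (by omega) (by simp at hm; omega)
  refine ⟨y.map (fill a (u ++ b :: v)), ?_⟩
  conv_lhs => rw [hy]
  rw [List.map_append, List.map_cons, fill_length, map_fill_append _ _ h1.lt]

/-- If `a + i` first occurs in `U` at position `q`, then it first occurs in `W(U)` where the `q`-th
parameter first occurs in `W`. -/
theorem Growth.initial_map_fill {a k m i : ℕ} {W U : List ℕ} (hW : Growth a (a + m) W)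
    (hU : Growth a (a + k) U) (hm : U.length = m) (hi : i < k) :
    initial (a + i) (W.map (fill a U)) =
      (initial (a + (initial (a + i) U).length) W).map (fill a (initial (a + i) U)) := by
  obtain ⟨v, hv, h1, -⟩ := hU.exists_initial (b := a + i) (by omega) (by omega)
  have hm' := hm
  rw [hv] at hm'
  obtain ⟨z, hz⟩ := hW.map_fill_eq hm'
  rw [← hv] at hz
  rw [hz, initial_append_cons]
  have hl : (initial (a + i) U).length < m := by
    simp at hm'; omega
  obtain ⟨_, -, h2, -⟩ := hW.exists_initial (b := a + (initial (a + i) U).length)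
    (by omega) (by omega)
  exact map_fill_lt (by omega) h2.lt h1.lt

/-! ### No parameters: Hales–Jewett -/

/-- The Graham–Rothschild property for growth words over `0, …, a - 1`, colouring words with
`d` parameters and looking for words with `m` parameters. -/
def GrahamRothschild (a d m : ℕ) : Prop :=
  ∀ (κ : Type) [Finite κ], ∃ N : ℕ, ∀ c : List ℕ → κ, ∃ W : List ℕ, W.length = N ∧
    Growth a (a + m) W ∧ ∀ U V : List ℕ, Growth a (a + d) U → Growth a (a + d) V →
      U.length = m → V.length = m → c (W.map (fill a U)) = c (W.map (fill a V))

/-- The block of length `m` for a coordinate of a combinatorial line over `Fin m → Fin a`. -/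
def lineBlock (a m : ℕ) : Option (Fin m → Fin a) → List ℕ
  | none => List.range' a m
  | some f => List.ofFn fun i => (f i : ℕ)

theorem length_lineBlock {a m : ℕ} (o : Option (Fin m → Fin a)) : (lineBlock a m o).length = m := by
  cases o <;> simp [lineBlock]

theorem lineBlock_some_lt {a m : ℕ} (f : Fin m → Fin a) : ∀ i ∈ lineBlock a m (some f), i < a := by
  intro i hi
  simp only [lineBlock, List.mem_ofFn] at hi
  obtain ⟨j, rfl⟩ := hi
  exact (f j).isLt

theorem lineBlock_lt {a m : ℕ} (o : Option (Fin m → Fin a)) : ∀ i ∈ lineBlock a m o, i < a + m := by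
  cases o with
  | none => exact (Growth.range' a m).lt
  | some f => exact fun i hi => (lineBlock_some_lt f i hi).trans_le (by omega)

/-- The first active block introduces all `m` parameters in order; blocks before it contain letters
only. -/
theorem growth_flatMap_lineBlock {ι : Type*} {a m : ℕ} (g : ι → Option (Fin m → Fin a))
    (L : List ι) (h : ∃ j ∈ L, g j = none) :
    Growth a (a + m) (L.flatMap fun j => lineBlock a m (g j)) := by
  induction L with
  | nil => simp at h
  | cons x L ih =>
    rw [List.flatMap_cons]
    cases hx : g x with
    | none =>
      refine (Growth.range' a m).append (.of_lt fun i hi => ?_)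
      obtain ⟨j, -, hj⟩ := List.mem_flatMap.1 hi
      exact lineBlock_lt _ i hj
    | some f =>
      refine (Growth.of_lt (lineBlock_some_lt f)).append (ih ?_)
      obtain ⟨j, hj, hj'⟩ := h
      rcases List.mem_cons.1 hj with rfl | hj
      · simp [hx] at hj'
      · exact ⟨j, hj, hj'⟩

theorem map_fill_lineBlock {a m : ℕ} (o : Option (Fin m → Fin a)) (f : Fin m → Fin a) :
    (lineBlock a m o).map (fill a (lineBlock a m (some f))) =
      lineBlock a m (some (o.getD f)) := by
  cases o with
  | none =>
    rw [Option.getD_none]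
    nth_rw 1 [lineBlock]
    rw [map_fill_range' _ _ (length_lineBlock _).ge, List.take_of_length_le (length_lineBlock _).le]
  | some g =>
    rw [Option.getD_some]
    conv_rhs => rw [← List.map_id (lineBlock a m (some g))]
    exact List.map_congr_left fun i hi => fill_of_lt _ (lineBlock_some_lt g i hi)

theorem exists_eq_lineBlock {a m : ℕ} {U : List ℕ} (hU : ∀ i ∈ U, i < a) (hm : U.length = m) :
    ∃ f, U = lineBlock a m (some f) := by
  subst hm
  refine ⟨fun i => ⟨U[i], hU _ (List.getElem_mem _)⟩, ?_⟩
  simp [lineBlock]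

/-- The multidimensional Hales–Jewett theorem. -/
theorem grahamRothschild_zero (a m : ℕ) : GrahamRothschild a 0 m := by
  intro κ _
  -- Taking `m`-tuples of letters as the alphabet turns one line into an `m`-dimensional subspace.
  obtain ⟨ι, _, hι⟩ := Combinatorics.Line.exists_mono_in_high_dimension (Fin m → Fin a) κ
  refine ⟨Fintype.card ι * m, fun c => ?_⟩
  obtain ⟨l, γ, hl⟩ := hι fun x =>
    c ((Finset.univ : Finset ι).toList.flatMap fun j => lineBlock a m (some (x j)))
  refine ⟨(Finset.univ : Finset ι).toList.flatMap fun j => lineBlock a m (l.idxFun j), ?_, ?_, ?_⟩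
  · simp [List.length_flatMap, length_lineBlock, Finset.card_univ]
  · obtain ⟨j, hj⟩ := l.proper
    exact growth_flatMap_lineBlock _ _ ⟨j, by simp, hj⟩
  · have key : ∀ U, Growth a (a + 0) U → U.length = m →
        c (((Finset.univ : Finset ι).toList.flatMap fun j => lineBlock a m (l.idxFun j)).map
          (fill a U)) = γ := by
      intro U hU hm
      obtain ⟨f, rfl⟩ := exists_eq_lineBlock (a := a) hU.lt hm
      rw [← hl f, List.map_flatMap]
      simp only [map_fill_lineBlock]
      rfl
    intro U V hU hV hUm hVm
    rw [key U hU hUm, key V hV hVm]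

/-! ### Dependence on the initial segment only -/

/-- Substituting in a suitable word makes the colour of a word with `d + 1` parameters depend only
on the part before the first parameter, if that part has length less than `p`. -/
theorem exists_color_eq_of_initial_eq {a d : ℕ} (ih : ∀ m, GrahamRothschild (a + 1) d m)
    (p M : ℕ) (κ : Type) [Finite κ] : ∃ N : ℕ, ∀ c : List ℕ → κ, ∃ W : List ℕ, W.length = N ∧
      Growth a (a + M) W ∧ ∀ u v w : List ℕ, u.length < p → (∀ i ∈ u, i < a) →
        Growth (a + 1) (a + 1 + d) v → Growth (a + 1) (a + 1 + d) w →
        u.length + 1 + v.length = M → u.length + 1 + w.length = M →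
        c (W.map (fill a (u ++ a :: v))) = c (W.map (fill a (u ++ a :: w))) := by
  induction p generalizing M with
  | zero =>
    exact ⟨M, fun c => ⟨List.range' a M, by simp, Growth.range' a M, by simp⟩⟩
  | succ p ihp =>
    -- Here no `u` of length `p` leaves room for the parameter `a`.
    by_cases hM : M ≤ p
    · obtain ⟨N, hN⟩ := ihp M
      refine ⟨N, fun c => ?_⟩
      obtain ⟨W, h1, h2, h3⟩ := hN c
      exact ⟨W, h1, h2, fun u v w hu hua hv hw hvM hwM =>
        h3 u v w (by omega) hua hv hw hvM hwM⟩
    obtain ⟨s, rfl⟩ : ∃ s, M = p + 1 + s := Nat.exists_eq_add_of_le (by omega)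
    -- Colours are functions of the initial word, so all `u` of length `p` are treated at once.
    obtain ⟨N', hN'⟩ := ih s ((Fin p → Fin a) → κ)
    obtain ⟨N, hN⟩ := ihp (p + 1 + N')
    refine ⟨N, fun c => ?_⟩
    obtain ⟨W, hWN, hW, hWc⟩ := hN c
    obtain ⟨V, hVN, hV, hVc⟩ := hN' fun w f =>
      c (W.map (fill a (lineBlock a p (some f) ++ a :: w)))
    -- The first `p + 1` parameters stay free. The shift sends the letter `a` of `V` to `a + p`, the
    -- last of them, which becomes `a` again when `u` has length `p`.
    set W' := List.range' a (p + 1) ++ V.map fun i => if i < a then i else i + p with hW'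
    have hW'len : W'.length = p + 1 + N' := by simp [hW', hVN]
    have hW'g : Growth a (a + (p + 1 + s)) W' := by
      have := hV.map_shift (p := p) (a := a) (by omega)
      rw [show a + 1 + p = a + (p + 1) by omega,
        show a + 1 + s + p = a + (p + 1 + s) by omega] at this
      exact (Growth.range' a (p + 1)).append this
    refine ⟨W.map (fill a W'), by simpa using hWN, hW.map_fill hW'g hW'len, ?_⟩
    intro u v w hu hua hv hw hvM hwM
    rw [map_fill_map_fill _ _ (by rw [hW'len]; exact hW.lt),
      map_fill_map_fill _ _ (by rw [hW'len]; exact hW.lt)]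
    rcases Nat.lt_succ_iff_lt_or_eq.1 hu with hu | hu
    -- For shorter `u`, substitution in `W'` preserves the beginning `u ++ [a]`, so the property of
    -- `W` applies.
    · have key : ∀ v, Growth (a + 1) (a + 1 + d) v → u.length + 1 + v.length = p + 1 + s →
          ∃ v', W'.map (fill a (u ++ a :: v)) = u ++ a :: v' ∧
            Growth (a + 1) (a + 1 + d) v' ∧ u.length + 1 + v'.length = p + 1 + N' := by
        intro v hv hvM
        have hl : (u ++ a :: v).length = p + 1 + s := by simp; omega
        have hg : Growth a (a + 1 + d) (W'.map (fill a (u ++ a :: v))) :=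
          hW'g.map_fill ((Growth.of_lt hua).append hv.new) hl
        obtain ⟨z, hz⟩ : ∃ z, W'.map (fill a (u ++ a :: v)) = u ++ a :: z := by
          rw [hW', List.map_append, map_fill_range' _ _ (by omega), List.take_append,
            List.take_of_length_le (by omega),
            show p + 1 - u.length = (p - u.length) + 1 by omega, List.take_succ_cons]
          simp
        have hzl := congrArg List.length hz
        rw [hz] at hg
        simp only [List.length_map, hW'len, List.length_append, List.length_cons] at hzl
        exact ⟨z, hz, (hg.of_append_of_lt hua).of_cons_self, by omega⟩
      obtain ⟨v', h1, h2, h3⟩ := key v hv hvM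
      obtain ⟨w', h1', h2', h3'⟩ := key w hw hwM
      rw [h1, h1']
      exact hWc u v' w' hu hua h2 h2' h3 h3'
    · obtain ⟨f, hf⟩ := exists_eq_lineBlock hua hu
      have key : ∀ v, u.length + 1 + v.length = p + 1 + s →
          W'.map (fill a (u ++ a :: v)) = u ++ a :: V.map (fill (a + 1) v) := by
        intro v hvM
        have hl : (u ++ a :: v).length = p + 1 + s := by simp; omega
        rw [hW', List.map_append, map_fill_range' _ _ (by omega), ← hu, List.take_append,
          List.take_of_length_le (by omega), List.map_map]
        simp only [Nat.add_sub_cancel_left, List.take_succ_cons, List.take_zero, List.append_assoc,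
          List.cons_append, List.nil_append]
        congr 2
        refine List.map_congr_left fun i _ => ?_
        rcases lt_trichotomy i a with hi | rfl | hi
        · simp [fill, hi, Nat.lt_succ_of_lt hi]
        · simp [fill]
        · obtain ⟨j, rfl⟩ := Nat.exists_eq_add_of_le (Nat.succ_le_of_lt hi)
          simp only [Function.comp, if_neg (show ¬ a.succ + j < a by omega)]
          rw [show a.succ + j + u.length = a + (u.length + (j + 1)) by omega, fill_add,
            show a.succ + j = a + 1 + j by omega, fill_add,
            List.getD_append_right _ _ _ _ (by omega)]
          simp
      rw [key v hvM, key w hwM, hf]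
      exact congrFun (hVc v w hv hw (by omega) (by omega)) f

/-! ### Making the initial segments monochromatic -/

theorem Growth.initial_append {a b k : ℕ} {w : List ℕ} (h : Growth a k w) (hab : a ≤ b)
    (hbk : b < k) (z : List ℕ) : initial b (w ++ z) = initial b w := by
  obtain ⟨v, hv, h1, -⟩ := h.exists_initial hab hbk
  conv_lhs => rw [hv]
  rw [List.append_assoc, List.cons_append, initial_append_cons _ h1.lt]

/-- Colouring all words over the letters, there is a word whose initial segments before
a parameter have, after substitution of letters, a colour depending on the parameter only. -/
theorem exists_initial_color_eq_of_length_eq (a t : ℕ) (κ : Type) [Finite κ] :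
    ∃ N : ℕ, ∀ c : List ℕ → κ, ∃ W : List ℕ, W.length = N ∧ Growth a (a + t) W ∧
      ∀ u v : List ℕ, (∀ i ∈ u, i < a) → (∀ i ∈ v, i < a) → u.length = v.length → u.length < t →
        c ((initial (a + u.length) W).map (fill a u)) =
          c ((initial (a + v.length) W).map (fill a v)) := by
  induction t with
  | zero => exact ⟨0, fun c => ⟨[], rfl, .nil a, by simp⟩⟩
  | succ t ih =>
    obtain ⟨N₁, h₁⟩ := ih
    obtain ⟨N₀, h₀⟩ := grahamRothschild_zero a N₁ κ
    refine ⟨N₀ + 1, fun c => ?_⟩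
    obtain ⟨W₀, hl₀, hW₀, hc₀⟩ := h₀ c
    obtain ⟨W₁, hl₁, hW₁, hc₁⟩ := h₁ fun v => c ((initial (a + v.length) W₀).map (fill a v))
    have hW : Growth a (a + t) (W₀.map (fill a W₁)) := hW₀.map_fill hW₁ hl₁
    -- The final `a + t` makes all of `W₀(W₁)` the initial segment for `u` of length `t`, where
    -- Hales–Jewett for `W₀` applies. Shorter `u` are handled by `W₁`.
    refine ⟨W₀.map (fill a W₁) ++ [a + t], by simp [hl₀], hW.append (.new (.nil _)), ?_⟩
    intro u v hu hv huv hut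
    rcases Nat.lt_succ_iff_lt_or_eq.1 hut with hut | hut
    · have key : ∀ w : List ℕ, w.length < t →
          (initial (a + w.length) (W₀.map (fill a W₁) ++ [a + t])).map (fill a w) =
            (initial (a + ((initial (a + w.length) W₁).map (fill a w)).length) W₀).map
              (fill a ((initial (a + w.length) W₁).map (fill a w))) := by
        intro w hw
        rw [hW.initial_append (by omega) (by omega), hW₀.initial_map_fill hW₁ hl₁ hw,
          map_fill_map_fill, List.length_map]
        obtain ⟨x, hx, -, -⟩ := hW₁.exists_initial (b := a + w.length) (by omega) (by omega)
        have hx := congrArg List.length hx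
        simp only [List.length_append, List.length_cons] at hx
        obtain ⟨-, -, h2, -⟩ := hW₀.exists_initial
          (b := a + (initial (a + w.length) W₁).length) (by omega) (by omega)
        exact h2.lt
      rw [key u hut, key v (huv ▸ hut)]
      exact hc₁ u v hu hv huv hut
    · have key : ∀ w : List ℕ, w.length = t → (∀ i ∈ w, i < a) →
          (initial (a + w.length) (W₀.map (fill a W₁) ++ [a + t])).map (fill a w) =
            W₀.map (fill a (W₁.map (fill a w))) ∧ Growth a (a + 0) (W₁.map (fill a w)) := by
        intro w hw hwa
        rw [hw, initial_append_cons _ hW.lt, map_fill_map_fill _ _ (by rw [hl₁]; exact hW₀.lt)]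
        exact ⟨rfl, hW₁.map_fill (.of_lt hwa) hw⟩
      obtain ⟨h1, h2⟩ := key u hut hu
      obtain ⟨h3, h4⟩ := key v (huv ▸ hut) hv
      rw [h1, h3]
      exact hc₀ _ _ h2 h4 (by simpa using hl₁) (by simpa using hl₁)

/-- The word with first occurrences of parameters exactly at the positions in `S`. -/
theorem growth_map_range {a : ℕ} (ha : 0 < a) (S : Finset ℕ) (M : ℕ) :
    Growth a (a + (S.filter (· < M)).card)
      ((List.range M).map fun q => if q ∈ S then a + (S.filter (· < q)).card else 0) := by
  induction M with
  | zero => simpa using Growth.nil a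
  | succ M ih =>
    rw [List.range_succ, List.map_append]
    refine ih.append ?_
    have hS : M ∉ S.filter (· < M) := by simp
    by_cases hM : M ∈ S
    · have : S.filter (· < M + 1) = insert M (S.filter (· < M)) := by
        ext x
        simp only [Finset.mem_filter, Finset.mem_insert, Nat.lt_succ_iff_lt_or_eq]
        constructor
        · rintro ⟨h, h' | h'⟩ <;> simp [h, h']
        · rintro (rfl | h) <;> simp_all
      rw [this, Finset.card_insert_of_notMem hS, ← Nat.add_assoc]
      simpa [hM] using Growth.new (.nil _)
    · have : S.filter (· < M + 1) = S.filter (· < M) := by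
        ext x
        simp only [Finset.mem_filter, Nat.lt_succ_iff_lt_or_eq]
        refine and_congr_right fun h => or_iff_left ?_
        rintro rfl
        exact hM h
      rw [this]
      simpa [hM] using Growth.old (by omega) (.nil _)

/-- By pigeonhole, `m` positions below `M` share a colour; the first occurrences of the parameters
are put there and the letter `0` elsewhere. -/
theorem exists_growth_color_length_initial {a : ℕ} (ha : 0 < a) (m : ℕ) (κ : Type) [Finite κ] :
    ∃ M : ℕ, ∀ f : ℕ → κ, ∃ W : List ℕ, W.length = M ∧ Growth a (a + m) W ∧
      ∃ γ, ∀ i < m, (initial (a + i) W).length < M ∧ f (initial (a + i) W).length = γ := by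
  classical
  have := Fintype.ofFinite κ
  refine ⟨Fintype.card κ * m, fun f => ?_⟩
  obtain ⟨γ, -, hγ⟩ := Finset.exists_le_card_fiber_of_mul_le_card_of_maps_to
    (s := Finset.range (Fintype.card κ * m)) (t := Finset.univ) (f := f) (n := m)
    (fun _ _ => Finset.mem_univ _) ⟨f 0, Finset.mem_univ _⟩ (by simp [Finset.card_univ])
  obtain ⟨S, hS, hSm⟩ := Finset.exists_subset_card_eq hγ
  have hW := growth_map_range ha S (Fintype.card κ * m)
  rw [Finset.filter_true_of_mem fun x hx => Finset.mem_range.1 (Finset.mem_filter.1 (hS hx)).1,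
    hSm] at hW
  refine ⟨_, by simp, hW, γ, fun i hi => ?_⟩
  obtain ⟨v, hv, -, -⟩ := hW.exists_initial (b := a + i) (by omega) (by omega)
  generalize hn : (initial (a + i) ((List.range (Fintype.card κ * m)).map fun q =>
    if q ∈ S then a + (S.filter (· < q)).card else 0)).length = n at *
  have h := congrArg (fun l => l[n]?) hv
  have hl := congrArg List.length hv
  simp only [List.length_map, List.length_range, List.length_append, List.length_cons, hn] at hl
  have hlt : n < Fintype.card κ * m := by omega
  simp only [← hn, List.getElem?_append_right le_rfl, Nat.sub_self, List.getElem?_cons_zero] at h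
  rw [hn] at h
  simp only [List.getElem?_map, List.getElem?_range hlt, Option.map_some, Option.some.injEq] at h
  -- Off `S` the entry would be `0`, which is less than `a + i` because `0 < a`.
  have hnS : n ∈ S := by
    by_contra hnS
    rw [if_neg hnS] at h
    omega
  exact ⟨hlt, (Finset.mem_filter.1 (hS hnS)).2⟩

/-- Colouring all words over the letters, there is a word whose initial segments before
a parameter have all the same colour after substitution of letters. -/
theorem exists_initial_color_eq (a m : ℕ) (κ : Type) [Finite κ] :
    ∃ N : ℕ, ∀ c : List ℕ → κ, ∃ W : List ℕ, W.length = N ∧ Growth a (a + m) W ∧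
      ∀ u v : List ℕ, (∀ i ∈ u, i < a) → (∀ i ∈ v, i < a) → u.length < m → v.length < m →
        c ((initial (a + u.length) W).map (fill a u)) =
          c ((initial (a + v.length) W).map (fill a v)) := by
  -- Without letters only the empty word can be substituted.
  rcases a.eq_zero_or_pos with rfl | ha
  · refine ⟨m, fun c => ⟨List.range' 0 m, by simp, Growth.range' 0 m, ?_⟩⟩
    intro u v hu hv _ _
    rw [List.eq_nil_iff_forall_not_mem (l := u) |>.2 fun i hi => Nat.not_lt_zero _ (hu i hi),
      List.eq_nil_iff_forall_not_mem (l := v) |>.2 fun i hi => Nat.not_lt_zero _ (hv i hi)]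
  obtain ⟨M, hM⟩ := exists_growth_color_length_initial ha m κ
  obtain ⟨N, hN⟩ := exists_initial_color_eq_of_length_eq a M κ
  refine ⟨N, fun c => ?_⟩
  obtain ⟨W, hl, hW, hc⟩ := hN c
  -- Since only the length matters, `q` zeros represent all words of length `q`.
  obtain ⟨V, hVl, hV, γ, hγ⟩ := hM fun q => c ((initial (a + q) W).map (fill a (.replicate q 0)))
  refine ⟨W.map (fill a V), by simpa using hl, hW.map_fill hV hVl, ?_⟩
  have key : ∀ w : List ℕ, (∀ i ∈ w, i < a) → w.length < m →
      c ((initial (a + w.length) (W.map (fill a V))).map (fill a w)) = γ := by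
    intro w hwa hw
    obtain ⟨h1, h2⟩ := hγ _ hw
    obtain ⟨-, -, h3, -⟩ := hV.exists_initial (b := a + w.length) (by omega) (by omega)
    obtain ⟨-, -, h4, -⟩ := hW.exists_initial
      (b := a + (initial (a + w.length) V).length) (by omega) (by omega)
    rw [hW.initial_map_fill hV hVl hw, map_fill_map_fill _ _ h4.lt, ← h2]
    have := hc ((initial (a + w.length) V).map (fill a w))
      (.replicate (initial (a + w.length) V).length 0)
      (map_fill_lt le_rfl h3.lt hwa) (fun i hi => by rwa [List.eq_of_mem_replicate hi])
      (by simp) (by simpa using h1)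
    simpa using this
  intro u v hu hv hum hvm
  rw [key u hu hum, key v hv hvm]

/-! ### Induction on the number of parameters -/

theorem grahamRothschild_succ {a d : ℕ} (ih : ∀ m, GrahamRothschild (a + 1) d m) (m : ℕ) :
    GrahamRothschild a (d + 1) m := by
  classical
  intro κ _
  obtain ⟨M, hM⟩ := exists_initial_color_eq a m κ
  obtain ⟨N, hN⟩ := exists_color_eq_of_initial_eq (a := a) ih M M κ
  refine ⟨N, fun c => ?_⟩
  obtain ⟨W, hl, hW, hc⟩ := hN c
  let tail (u : List ℕ) : Prop := ∃ w, Growth (a + 1) (a + 1 + d) w ∧ u.length + 1 + w.length = M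
  -- The chosen tail is immaterial by `hc`; `c []` is a default for words admitting no tail.
  obtain ⟨V, hVl, hV, hVc⟩ := hM fun u =>
    if h : tail u then c (W.map (fill a (u ++ a :: h.choose))) else c []
  refine ⟨W.map (fill a V), by simpa using hl, hW.map_fill hV hVl, ?_⟩
  have key : ∀ U, Growth a (a + (d + 1)) U → U.length = m → ∃ u : List ℕ,
      (∀ i ∈ u, i < a) ∧ u.length < m ∧ c ((W.map (fill a V)).map (fill a U)) =
        if h : tail ((initial (a + u.length) V).map (fill a u)) then
          c (W.map (fill a ((initial (a + u.length) V).map (fill a u) ++ a :: h.choose)))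
        else c [] := by
    intro U hU hUm
    obtain ⟨u, w, rfl, hu, hw⟩ := hU.exists_split le_rfl (by omega)
    have hum : u.length < m := by simp at hUm; omega
    refine ⟨u, hu.lt, hum, ?_⟩
    obtain ⟨z, hz⟩ := hV.map_fill_eq hUm
    have hg := hV.map_fill hU hUm
    have hzl := congrArg List.length hz
    rw [hz] at hg
    obtain ⟨-, -, h1, -⟩ := hV.exists_initial (b := a + u.length) (by omega) (by omega)
    have hxa := map_fill_lt le_rfl h1.lt hu.lt
    have hzg := (hg.of_append_of_lt hxa).of_cons_self
    rw [show a + (d + 1) = a + 1 + d by omega] at hzg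
    rw [map_fill_map_fill _ _ (by rw [hVl]; exact hW.lt), hz]
    generalize (initial (a + u.length) V).map (fill a u) = x at *
    simp only [List.length_map, hVl, List.length_append, List.length_cons] at hzl
    have ht : tail x := ⟨z, hzg, by omega⟩
    rw [dif_pos ht]
    exact hc x z _ (by omega) hxa hzg ht.choose_spec.1 (by omega) ht.choose_spec.2
  intro U U' hU hU' hUm hUm'
  obtain ⟨u, h1, h2, h3⟩ := key U hU hUm
  obtain ⟨u', h1', h2', h3'⟩ := key U' hU' hUm'
  rw [h3, h3']
  exact hVc u u' h1 h1' h2 h2'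

/-- The Graham–Rothschild theorem for growth words. -/
theorem grahamRothschild (d : ℕ) : ∀ a m, GrahamRothschild a d m := by
  induction d with
  | zero => exact grahamRothschild_zero
  | succ d ih => exact fun a m => grahamRothschild_succ (ih (a + 1)) m

/-! ### Transfer to parameter words -/

theorem Growth.of_forall {a k : ℕ} {w : List ℕ} (hak : a ≤ k) (hlt : ∀ i ∈ w, i < k)
    (hmem : ∀ b, a ≤ b → b < k → b ∈ w)
    (hord : ∀ b, a ≤ b → ∀ u v, w = u ++ (b + 1) :: v → b ∈ u) : Growth a k w := by
  induction w generalizing a with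
  | nil =>
    rcases hak.eq_or_lt with rfl | h
    · exact .nil a
    · simpa using hmem a le_rfl h
  | cons x w ih =>
    have hlt' : ∀ i ∈ w, i < k := fun i hi => hlt i (by simp [hi])
    have key : ∀ b, x < b → a ≤ b → (b < k → b ∈ w) ∧
        ∀ u v, w = u ++ (b + 1) :: v → b ∈ u := by
      intro b hxb hab
      refine ⟨fun hb => (List.mem_cons.1 (hmem b hab hb)).resolve_left (by omega), ?_⟩
      rintro u v rfl
      exact (List.mem_cons.1 (hord b hab (x :: u) v rfl)).resolve_left (by omega)
    rcases lt_trichotomy x a with hx | rfl | hx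
    · exact .old hx (ih hak hlt' (fun b hb => (key b (by omega) hb).1)
        fun b hb => (key b (by omega) hb).2)
    · exact .new (ih (hlt x (by simp)) hlt' (fun b hb => (key b (by omega) (by omega)).1)
        fun b hb => (key b (by omega) (by omega)).2)
    · obtain ⟨b, rfl⟩ := Nat.exists_eq_add_of_lt hx
      simpa using hord (a + b) (by omega) [] w rfl

theorem Growth.mem {a b k : ℕ} {w : List ℕ} (h : Growth a k w) (hab : a ≤ b) (hbk : b < k) :
    b ∈ w := by
  obtain ⟨u, v, rfl, -⟩ := h.exists_split hab hbk
  simp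

theorem Growth.exists_lt_getElem_eq {a b k q : ℕ} {w : List ℕ} (h : Growth a k w) (hab : a ≤ b)
    (hq : q < w.length) (hb : w[q] = b + 1) :
    ∃ (p : ℕ) (hp : p < q), w[p]'(hp.trans hq) = b := by
  have hk : b + 1 < k := hb ▸ h.lt _ (List.getElem_mem hq)
  obtain ⟨u, v, rfl, hu, -⟩ := h.exists_split (by omega) hk
  obtain ⟨p, hp, hpb⟩ := List.getElem_of_mem (hu.mem hab (by omega))
  have huq : u.length ≤ q := by
    by_contra hlt
    rw [List.getElem_append_left (by omega)] at hb
    have := hu.lt _ (List.getElem_mem (not_le.1 hlt))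
    omega
  exact ⟨p, by omega, by rw [List.getElem_append_left hp, hpb]⟩

namespace ParamWord

variable {A : Type*} {P : Set A} {a k m n : ℕ}

theorem eq_of_letter_eq {X Y : ParamWord A k n} (h : ∀ p, X.letter p = Y.letter p) : X = Y := by
  cases X
  cases Y
  congr
  exact funext h

/-- The symbol of a parameter word coded by a natural number: the numbers below `a` code letters,
the others parameters. -/
def decode (e : P ≃ Fin a) (k : ℕ) [NeZero k] (i : ℕ) : A ⊕ Fin k :=
  if h : i < a then .inl (e.symm ⟨i, h⟩ : P) else .inr (Fin.ofNat k (i - a))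

variable (e : P ≃ Fin a) [NeZero k]

theorem decode_of_lt {i : ℕ} (h : i < a) : decode e k i = .inl (e.symm ⟨i, h⟩ : P) := dif_pos h

theorem decode_add (i : Fin k) : decode e k (a + i) = .inr i := by
  simp [decode]

theorem eq_of_decode_eq_inr {i : ℕ} (hi : i < a + k) {j : Fin k} (h : decode e k i = .inr j) :
    i = a + j := by
  by_cases hia : i < a
  · simp [decode_of_lt e hia] at h
  · obtain ⟨l, rfl⟩ := Nat.exists_eq_add_of_le (not_lt.1 hia)
    have := decode_add e (⟨l, by omega⟩ : Fin k)
    rw [h] at this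
    rw [Sum.inr.inj this]

theorem exists_decode {s : A ⊕ Fin k} (h : ∀ x, s = .inl x → x ∈ P) :
    ∃ i < a + k, decode e k i = s := by
  rcases s with x | j
  · exact ⟨e ⟨x, h x rfl⟩, by omega, by rw [decode_of_lt e (Fin.is_lt _)]; simp⟩
  · exact ⟨a + j, by omega, decode_add e j⟩

theorem exists_of_growth {w : List ℕ} (hw : Growth a (a + k) w) (hn : w.length = n) :
    ∃ W : ParamWord A k n, W.InAlphabet P ∧ ∀ p, W.letter p = decode e k (w.getD p 0) := by
  subst hn
  have hd : ∀ p : Fin w.length, w.getD p 0 = w[p] := fun p => List.getD_eq_getElem _ _ p.isLt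
  have hlt : ∀ p : Fin w.length, w[p] < a + k := fun p => hw.lt _ (List.getElem_mem _)
  refine ⟨⟨fun p => decode e k w[p], fun i => ?_, fun i j hij q hq => ?_⟩, ?_, fun p => by rw [hd]⟩
  · obtain ⟨p, hp, h⟩ := List.getElem_of_mem (hw.mem (b := a + i) (by omega) (by omega))
    exact ⟨⟨p, hp⟩, by simp only [Fin.getElem_fin, h]; exact decode_add e i⟩
  · have := eq_of_decode_eq_inr e (hlt q) hq
    obtain ⟨p, hp, h⟩ := hw.exists_lt_getElem_eq (b := a + i) (by omega) q.isLt
      (by rw [← Fin.getElem_fin, this]; omega)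
    exact ⟨⟨p, hp.trans q.isLt⟩, hp, by simp only [Fin.getElem_fin, h]; exact decode_add e i⟩
  · intro p x hx
    dsimp only at hx
    by_cases h : w[p] < a
    · rw [decode_of_lt e h] at hx
      rw [← Sum.inl.inj hx]
      exact Subtype.mem _
    · rw [decode, dif_neg h] at hx
      simp at hx

theorem exists_growth {U : ParamWord A k n} (hU : U.InAlphabet P) :
    ∃ u : List ℕ, u.length = n ∧ Growth a (a + k) u ∧
      ∀ p : Fin n, U.letter p = decode e k (u.getD p 0) := by
  choose f hf hfd using fun p => exists_decode e (s := U.letter p) fun x hx => hU p x hx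
  refine ⟨List.ofFn f, by simp, .of_forall (by omega) ?_ ?_ ?_, ?_⟩
  · intro i hi
    obtain ⟨p, rfl⟩ := List.mem_ofFn.1 hi
    exact hf p
  · intro b hab hbk
    obtain ⟨p, hp⟩ := U.occurs ⟨b - a, by omega⟩
    rw [← hfd] at hp
    have := eq_of_decode_eq_inr e (hf p) hp
    exact List.mem_ofFn.2 ⟨p, by dsimp only at this; omega⟩
  · intro b hab u v huv
    have hl := congrArg List.length huv
    simp only [List.length_ofFn, List.length_append, List.length_cons] at hl
    have hq : f ⟨u.length, by omega⟩ = b + 1 := by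
      have := congrArg (fun l => l[u.length]?) huv
      simpa [show u.length < n by omega] using this
    have hb := hf ⟨u.length, by omega⟩
    rw [hq] at hb
    have hq' := hfd ⟨u.length, by omega⟩
    rw [hq, show b + 1 = a + (⟨b + 1 - a, by omega⟩ : Fin k) by dsimp only; omega,
      decode_add] at hq'
    obtain ⟨p, hp, hpl⟩ := U.ordered ⟨b - a, by omega⟩ _ (by dsimp only; omega) _ hq'.symm
    rw [← hfd] at hpl
    have hpb := eq_of_decode_eq_inr e (hf p) hpl
    have hpu : (p : ℕ) < u.length := hp
    have hpv := congrArg (fun l => l[(p : ℕ)]?) huv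
    simp only [List.getElem?_append_left hpu] at hpv
    rw [List.getElem?_eq_getElem (by simp), List.getElem?_eq_getElem hpu] at hpv
    simp only [List.getElem_ofFn, Option.some.injEq, Fin.eta] at hpv
    have : b = u[(p : ℕ)] := by rw [← hpv]; dsimp only at hpb; omega
    rw [this]
    exact List.getElem_mem _
  · intro p
    rw [List.getD_eq_getElem _ _ (by simp)]
    simp [hfd]

theorem subst_letter_eq_decode [NeZero m] {W : ParamWord A m n} {U : ParamWord A k m}
    {w u : List ℕ} (hn : w.length = n) (hw : ∀ i ∈ w, i < a + m)
    (hW : ∀ p : Fin n, W.letter p = decode e m (w.getD p 0))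
    (hU : ∀ p : Fin m, U.letter p = decode e k (u.getD p 0)) (p : Fin n) :
    (W.subst U).letter p = decode e k ((w.map (fill a u)).getD p 0) := by
  have hp : (p : ℕ) < w.length := hn ▸ p.isLt
  change Sum.elim Sum.inl U.letter (W.letter p) = _
  rw [hW, List.getD_eq_getElem _ _ hp, List.getD_eq_getElem _ _ (by simpa using hp),
    List.getElem_map]
  have hlt := hw _ (List.getElem_mem hp)
  generalize w[(p : ℕ)] = i at hlt
  by_cases h : i < a
  · rw [fill_of_lt _ h, decode_of_lt e h, decode_of_lt e h, Sum.elim_inl]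
  · obtain ⟨l, rfl⟩ := Nat.exists_eq_add_of_le (not_lt.1 h)
    have := decode_add e (⟨l, by omega⟩ : Fin m)
    dsimp only at this
    rw [this, fill_add, Sum.elim_inr, hU]

end ParamWord

theorem mainTheorem10 {A : Type*} [Finite A] (P : Set A) (k r m : ℕ)
    (hk : 0 < k) (hkm : k < m) (hr : 0 < r) :
    ∃ N : ℕ, 0 < N ∧ ∀ χ : ParamWord A k N → Fin r,
      ∃ W : ParamWord A m N, W.InAlphabet P ∧
        ∃ c : Fin r, ∀ U : ParamWord A k m, U.InAlphabet P → χ (W.subst U) = c := by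
  classical
  have : NeZero k := ⟨by omega⟩
  have : NeZero m := ⟨by omega⟩
  let e : P ≃ Fin (Nat.card P) := Finite.equivFin P
  obtain ⟨N, hN⟩ := grahamRothschild k (Nat.card P) m (Fin r)
  refine ⟨N, ?_, fun χ => ?_⟩
  · obtain ⟨W, hl, hW, -⟩ := hN fun _ => ⟨0, hr⟩
    have := hW.le_length
    omega
  -- `χ` is extended to lists through decoding; a parameter word is determined by its letters, so
  -- the choice is harmless.
  obtain ⟨w, hl, hw, hc⟩ := hN fun w =>
    if h : ∃ X : ParamWord A k N, ∀ p, X.letter p = ParamWord.decode e k (w.getD p 0) then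
      χ h.choose else ⟨0, hr⟩
  obtain ⟨W, hWP, hWd⟩ := ParamWord.exists_of_growth e hw hl
  refine ⟨W, hWP, ?_⟩
  have key : ∀ U : ParamWord A k m, U.InAlphabet P → ∃ u : List ℕ, u.length = m ∧
      Growth (Nat.card P) (Nat.card P + k) u ∧ χ (W.subst U) =
        if h : ∃ X : ParamWord A k N, ∀ p, X.letter p =
            ParamWord.decode e k ((w.map (fill (Nat.card P) u)).getD p 0) then
          χ h.choose else ⟨0, hr⟩ := by
    intro U hU
    obtain ⟨u, hul, hu, hud⟩ := ParamWord.exists_growth e hU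
    refine ⟨u, hul, hu, ?_⟩
    have hX := ParamWord.subst_letter_eq_decode e hl hw.lt hWd hud
    have hex : ∃ X : ParamWord A k N, ∀ p, X.letter p =
      ParamWord.decode e k ((w.map (fill (Nat.card P) u)).getD p 0) := ⟨_, hX⟩
    rw [dif_pos hex]
    exact congrArg χ (ParamWord.eq_of_letter_eq fun p => (hX p).trans (hex.choose_spec p).symm)
  by_cases hex : ∃ U : ParamWord A k m, U.InAlphabet P
  · obtain ⟨U₀, hU₀⟩ := hex
    refine ⟨χ (W.subst U₀), fun U hU => ?_⟩
    obtain ⟨u, h1, h2, h3⟩ := key U hU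
    obtain ⟨u₀, h1', h2', h3'⟩ := key U₀ hU₀
    rw [h3, h3']
    exact hc u u₀ h2 h2' h1 h1'
  · exact ⟨⟨0, hr⟩, fun U hU => absurd ⟨U, hU⟩ hex⟩
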